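/- The \emph{Z-order (Morton) curve} visits the cells of the grid $\mathbb{N}\times\mathbb{N}$; its $i$-th cell ($i=0,1,2,\dots$) is $Z(i)=(x,y)$, where the binary digits of $x$ are the digits of $i$ at the even places $0,2,4,\dots$ and those of $y$ are the digits of $i$ at the odd places $1,3,5,\dots$. (Its first $4^m$ cells fill the $2^m\times 2^m$ grid.) Sending a message from the $i$-th to the $j$-th cell costs as \emph{energy} the Manhattan distance $\mathrm{dist}(i,j)=\|Z(i)-Z(j)\|_1$. Let $T$ be a rooted tree with $n$ vertices, and write $s(v)$ for the number of vertices of the subtree rooted at $v$. $T$ is \emph{stored in light-first order} on the curve if its vertices $v$ have positions $p_v\in\mathbb{N}$ along the curve such that the root has position $0$ and the children of each vertex $v$ can be listed as $c_1,\dots,c_d$ with $s(c_1)\le\dots\le s(c_d)$ and $p_{c_i}=1+p_v+\sum_{j<i}s(c_j)$ for $i=1,\dots,d$. \textbf{Theorem.} Light-first order on the Z-order curve is energy-bound, although the curve is not distance-bound. That is: (1) For every $\Delta\in\mathbb{N}$ there is a constant $C$, depending only on $\Delta$, such that for every finite rooted tree $T$ in which each vertex has at most $\Delta$ children, and every storage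 of $T$ in light-first order on the Z-order curve, the total energy of each vertex sending a message to all its children satisfies $$\sum_{v}\ \sum_{c\text{ child of }v}\mathrm{dist}(p_v,p_c)\ \le\ C\,n ,$$ where $n$ is the number of vertices of $T$. (2) There is no constant $c$ such that $\mathrm{dist}(i,i+j)\le c\sqrt{j}$ for all $i,j\in\mathbb{N}$. -/

import Mathlib

universe u

/-- The position on the grid (column, row) of the `i`-th element, counted from `0`, of the Z-order
(Morton) curve. The bits of `i` at even places are the bits of the column, those at odd places are
the bits of the row: the last base-4 digit of `i` gives the last bit of both coordinates. -/
def zCurve (i : ℕ) : ℕ × ℕ :=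
  if h : i = 0 then (0, 0)
  else (2 * (zCurve (i / 4)).1 + i % 2, 2 * (zCurve (i / 4)).2 + i / 2 % 2)
termination_by i
decreasing_by all_goals omega

/-- The energy of sending a message between two processors of the grid: their Manhattan distance. -/
def gridEnergy (a b : ℕ × ℕ) : ℕ := Nat.dist a.1 b.1 + Nat.dist a.2 b.2

/-- The energy of sending a message from the `i`-th to the `j`-th processor along the curve `K`,
where `K i` is the grid position of the `i`-th element of the curve. -/
def curveEnergy (K : ℕ → ℕ × ℕ) (i j : ℕ) : ℕ := gridEnergy (K i) (K j)

/-- Sending a message from the `i`-th to the `(i + j)`-th processor takes `O(√j)` energy. -/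
def IsDistanceBound (K : ℕ → ℕ × ℕ) : Prop :=
  ∃ c : ℝ, ∀ i j : ℕ, (curveEnergy K i (i + j) : ℝ) ≤ c * √(j : ℝ)

/-- The set of children of the vertex `v`. In the ancestor order `u ≤ w` of a rooted tree
(`u` is an ancestor of `w` or `w` itself), these are the vertices that cover `v`. -/
def treeChildren {T : RootedTree.{u}} (v : T) : Set T := {c : T | v ⋖ c}

/-- The size of the subtree rooted at `v`: the number of descendants of `v`, with `v` included. -/
noncomputable def subtreeSize {T : RootedTree.{u}} (v : T) : ℕ := (Set.Ici v).ncard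

/-- The neighborhood of `v` is in light-first order when `pos w` is the position along the curve of
the vertex `w`: the children of `v` can be listed as `c 0, …, c (d - 1)`, each of them once, with
nondecreasing subtree sizes, so that each `c i` has position
`1 + pos v + (sum of the subtree sizes of the c j with j < i)`. -/
def HasLightFirstNeighborhood {T : RootedTree.{u}} (pos : T → ℕ) (v : T) : Prop :=
  ∃ (d : ℕ) (c : Fin d → T), Function.Injective c ∧ Set.range c = treeChildren v ∧
    Monotone (fun i => subtreeSize (c i)) ∧
    ∀ i : Fin d, pos (c i) = 1 + pos v + ∑ j ∈ Finset.Iio i, subtreeSize (c j)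

/-- The tree is stored in light-first order: the root is the first element of the curve and the
neighborhood of every vertex is in light-first order. -/
def IsLightFirst {T : RootedTree.{u}} (pos : T → ℕ) : Prop :=
  pos (⊥ : T) = 0 ∧ ∀ v : T, HasLightFirstNeighborhood pos v

open Classical in
/-- The total energy of each vertex sending a message to all its children. -/
noncomputable def messagingEnergy (K : ℕ → ℕ × ℕ) {T : RootedTree.{u}} [Fintype T]
    (pos : T → ℕ) : ℕ :=
  ∑ v : T, ∑ c : T with c ∈ treeChildren v, curveEnergy K (pos v) (pos c)

/-- Light-first order on the curve `K` is energy-bound: for every constant degree bound `Δ`, each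
vertex sending a message to all its children takes `O(n)` energy in total, for all trees with `n`
vertices, with at most `Δ` children per vertex, that are stored in light-first order on `K`. -/
def IsLightFirstEnergyBound (K : ℕ → ℕ × ℕ) : Prop :=
  ∀ Δ : ℕ, ∃ C : ℝ, ∀ (T : RootedTree.{u}) [Fintype T] (pos : T → ℕ),
    (∀ v : T, (treeChildren v).ncard ≤ Δ) → IsLightFirst pos →
      (messagingEnergy K pos : ℝ) ≤ C * (Fintype.card T : ℝ)

/-! An edge that spans `s` positions of the Z-order curve costs `O(√s)`, plus about `2 ^ k` if it
crosses a block boundary at a multiple of `4 ^ k` with `4 ^ k` larger than `s`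
(`curveEnergy_zCurve_le`). Spread this cost over the positions between the ends: each pays `O(1 /
√s)`, and the one just before the boundary also pays for the crossing.

Between a vertex and its child lie only the vertex itself and descendants of lighter siblings. So
`u` pays only for edges leaving `u` or leaving the parent of a light ancestor of `u`. Subtree sizes
more than double from one light ancestor to the next one up, so each dyadic scale occurs at most
once (`injOn_log_subtreeSize`). Over all scales the root shares form a geometric series. A boundary
of order `k` is charged by at most `k` scales and has density `4 ^ (-k)`, so crossings average `∑ k
* 2 ^ (-k) = O(1)` per position. -/

/-! ### Geometry of the Z-order curve -/

/-- Each base-4 digit of the index supplies one bit of each coordinate, so dropping `k` digits drops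
`k` bits. -/
theorem zCurve_fst_div (k i : ℕ) : (zCurve i).1 / 2 ^ k = (zCurve (i / 4 ^ k)).1 := by
  induction k generalizing i with
  | zero => simp
  | succ k ih =>
    have h : (zCurve i).1 / 2 = (zCurve (i / 4)).1 := by
      rw [zCurve.eq_def i]
      split_ifs with h
      · subst h; simp [zCurve]
      · simp only; omega
    rw [pow_succ', ← Nat.div_div_eq_div_mul, h, ih, pow_succ', Nat.div_div_eq_div_mul]

theorem zCurve_snd_div (k i : ℕ) : (zCurve i).2 / 2 ^ k = (zCurve (i / 4 ^ k)).2 := by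
  induction k generalizing i with
  | zero => simp
  | succ k ih =>
    have h : (zCurve i).2 / 2 = (zCurve (i / 4)).2 := by
      rw [zCurve.eq_def i]
      split_ifs with h
      · subst h; simp [zCurve]
      · simp only; omega
    rw [pow_succ', ← Nat.div_div_eq_div_mul, h, ih, pow_succ', Nat.div_div_eq_div_mul]

theorem Nat.dist_le_of_div_eq {a b c : ℕ} (hc : 0 < c) (h : a / c = b / c) :
    Nat.dist a b ≤ c := by
  have ha := Nat.div_add_mod a c
  have hb := Nat.div_add_mod b c
  have := Nat.mod_lt a hc
  have := Nat.mod_lt b hc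
  rw [h] at ha
  unfold Nat.dist
  omega

theorem gridEnergy_triangle (a b c : ℕ × ℕ) :
    gridEnergy a c ≤ gridEnergy a b + gridEnergy b c := by
  unfold gridEnergy Nat.dist
  omega

/-- Two elements of the Z-order curve in the same aligned block of `4 ^ k` elements. -/
theorem curveEnergy_zCurve_le_of_div_eq {k i j : ℕ} (h : i / 4 ^ k = j / 4 ^ k) :
    curveEnergy zCurve i j ≤ 2 * 2 ^ k := by
  have h1 := Nat.dist_le_of_div_eq (a := (zCurve i).1) (b := (zCurve j).1) (c := 2 ^ k)
    (by positivity) (by rw [zCurve_fst_div, zCurve_fst_div, h])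
  have h2 := Nat.dist_le_of_div_eq (a := (zCurve i).2) (b := (zCurve j).2) (c := 2 ^ k)
    (by positivity) (by rw [zCurve_snd_div, zCurve_snd_div, h])
  unfold curveEnergy gridEnergy
  omega

theorem Nat.pred_mul_div {a b : ℕ} (hb : 0 < b) (ha : 0 < a) : (a * b - 1) / b = a - 1 := by
  obtain ⟨a, rfl⟩ := Nat.exists_eq_add_of_lt ha
  rw [Nat.div_eq_iff hb]
  simp only [zero_add, Nat.add_sub_cancel]
  constructor
  · have : (a + 1) * b = a * b + b := by ring
    omega
  · have : (a + 1) * b = a * b + b := by ring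
    omega

/-- The step of the Z-order curve onto an element whose index is divisible by `4 ^ k`,
but not by `4 ^ (k + 1)`. -/
theorem curveEnergy_zCurve_pred_le {k B : ℕ} (h : ¬ 4 ^ (k + 1) ∣ B) :
    curveEnergy zCurve (B - 1) B ≤ 4 * 2 ^ k := by
  have h1 : (B - 1) / 4 ^ (k + 1) = B / 4 ^ (k + 1) := by
    have hB := Nat.div_add_mod B (4 ^ (k + 1))
    have h0 : B % 4 ^ (k + 1) ≠ 0 := fun h' => h (Nat.dvd_of_mod_eq_zero h')
    have := Nat.mod_lt B (show 0 < 4 ^ (k + 1) by positivity)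
    rw [Nat.div_eq_iff (by positivity), mul_comm]
    omega
  have := curveEnergy_zCurve_le_of_div_eq h1
  rw [pow_succ] at this
  omega

/-- Elements of the Z-order curve at index distance at most `4 ^ m` are as close as elements of a
common block of size `4 ^ m`, up to one step across the boundary of a larger block. -/
theorem curveEnergy_zCurve_le {m i j : ℕ} (hij : i ≤ j) (hm : j - i ≤ 4 ^ m) :
    curveEnergy zCurve i j ≤ 4 * 2 ^ m ∨
    ∃ k, ∃ t ∈ Finset.Ico i j, m ≤ k ∧ 4 ^ k ∣ t + 1 ∧
      curveEnergy zCurve i j ≤ 4 * 2 ^ m + 4 * 2 ^ k := by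
  by_cases h : i / 4 ^ m = j / 4 ^ m
  · left
    have := curveEnergy_zCurve_le_of_div_eq h
    omega
  right
  have hpos : 0 < 4 ^ m := by positivity
  set a := j / 4 ^ m with ha
  have hlt : i / 4 ^ m < a := lt_of_le_of_ne (Nat.div_le_div_right hij) h
  have ha0 : 0 < a := Nat.zero_lt_of_lt hlt
  have hiB : i < a * 4 ^ m := (Nat.div_lt_iff_lt_mul hpos).1 hlt
  have hBj : a * 4 ^ m ≤ j := Nat.div_mul_le_self j _
  -- As `j - i ≤ 4 ^ m`, the blocks of `i` and `j` are adjacent, and `a * 4 ^ m` is the only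
  -- boundary crossed.
  have hi : i / 4 ^ m = a - 1 := by
    have : a - 1 ≤ i / 4 ^ m := by
      rw [Nat.le_div_iff_mul_le hpos, Nat.sub_mul]
      omega
    omega
  obtain ⟨k, b, hb, hk⟩ := Nat.exists_eq_pow_mul_and_not_dvd (n := a) ha0.ne' 4 (by norm_num)
  have hB : a * 4 ^ m = 4 ^ (m + k) * b := by rw [hk]; ring
  refine ⟨m + k, a * 4 ^ m - 1, ?_, by omega, ?_, ?_⟩
  · rw [Finset.mem_Ico]
    omega
  · rw [Nat.sub_add_cancel (by omega), hB]
    exact dvd_mul_right _ _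
  · have e1 : curveEnergy zCurve i (a * 4 ^ m - 1) ≤ 2 * 2 ^ m :=
      curveEnergy_zCurve_le_of_div_eq (by rw [hi, Nat.pred_mul_div hpos ha0])
    have e2 : curveEnergy zCurve (a * 4 ^ m - 1) (a * 4 ^ m) ≤ 4 * 2 ^ (m + k) := by
      apply curveEnergy_zCurve_pred_le
      rw [hB, pow_succ]
      intro hd
      exact hb (Nat.dvd_of_mul_dvd_mul_left (by positivity) hd)
    have e3 : curveEnergy zCurve (a * 4 ^ m) j ≤ 2 * 2 ^ m :=
      curveEnergy_zCurve_le_of_div_eq (by rw [Nat.mul_div_cancel _ hpos])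
    have t1 := gridEnergy_triangle (zCurve i) (zCurve (a * 4 ^ m - 1)) (zCurve (a * 4 ^ m))
    have t2 := gridEnergy_triangle (zCurve i) (zCurve (a * 4 ^ m)) (zCurve j)
    unfold curveEnergy at *
    omega

theorem zCurve_four_pow (k : ℕ) : zCurve (4 ^ k) = (2 ^ k, 0) := by
  induction k with
  | zero => simp [zCurve]
  | succ k ih =>
    rw [zCurve, dif_neg (by positivity), pow_succ, Nat.mul_div_cancel _ (by norm_num), ih]
    ext <;> simp only <;> omega

theorem zCurve_four_pow_sub_one (k : ℕ) : zCurve (4 ^ k - 1) = (2 ^ k - 1, 2 ^ k - 1) := by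
  induction k with
  | zero => simp [zCurve]
  | succ k ih =>
    have h4 : 0 < 4 ^ k := by positivity
    have h2 : 0 < 2 ^ k := by positivity
    have : (4 ^ (k + 1) - 1) / 4 = 4 ^ k - 1 := by omega
    rw [zCurve, dif_neg (by omega), this, ih]
    ext <;> simp only <;> omega

/-- The single step out of the first `2 ^ k × 2 ^ k` square drops from its top row to row `0`. -/
theorem not_isDistanceBound_zCurve : ¬ IsDistanceBound zCurve := by
  rintro ⟨c, hc⟩
  obtain ⟨k, hk⟩ := pow_unbounded_of_one_lt c (show (1 : ℝ) < 2 by norm_num)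
  have h := hc (4 ^ k - 1) 1
  rw [Nat.sub_add_cancel (Nat.one_le_pow k 4 (by norm_num)), curveEnergy, zCurve_four_pow,
    zCurve_four_pow_sub_one] at h
  have h2 : 0 < 2 ^ k := by positivity
  have : 2 ^ k ≤ gridEnergy (2 ^ k - 1, 2 ^ k - 1) (2 ^ k, 0) := by
    unfold gridEnergy Nat.dist
    simp only
    omega
  have : (2 : ℝ) ^ k ≤ gridEnergy (2 ^ k - 1, 2 ^ k - 1) (2 ^ k, 0) := by exact_mod_cast this
  simp only [Nat.cast_one, Real.sqrt_one, mul_one] at h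
  linarith

/-! ### Light-first positions and charging to light ancestors -/

theorem Fin.exists_sum_Iio_le_lt {d : ℕ} (s : Fin d → ℕ) {t : ℕ} (h : t < ∑ i, s i) :
    ∃ i, ∑ j ∈ Finset.Iio i, s j ≤ t ∧ t < ∑ j ∈ Finset.Iio i, s j + s i := by
  induction d with
  | zero => simp at h
  | succ d ih =>
    rw [Fin.sum_univ_castSucc] at h
    by_cases ht : t < ∑ i : Fin d, s i.castSucc
    · obtain ⟨i, hi⟩ := ih (fun i => s i.castSucc) ht
      refine ⟨i.castSucc, ?_⟩
      rwa [← Fin.map_castSuccEmb_Iio, Finset.sum_map]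
    · refine ⟨Fin.last d, ?_⟩
      have : ∑ j ∈ Finset.Iio (Fin.last d), s j = ∑ i : Fin d, s i.castSucc := by
        rw [Fin.Iio_last_eq_map, Finset.sum_map]
        rfl
      omega

theorem CovBy.eq_of_le_of_le {α : Type*} [PartialOrder α] [PredOrder α] [IsPredArchimedean α]
    {v c c' x : α} (h : v ⋖ c) (h' : v ⋖ c') (hx : c ≤ x) (hx' : c' ≤ x) : c = c' := by
  rcases le_total_of_directed hx hx' with hle | hle
  · exact (hle.eq_of_not_lt (h.2 h'.lt)).symm
  · exact hle.eq_of_not_lt (h'.2 h.lt)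

section Tree

variable {T : RootedTree.{u}}

theorem subtreeSize_pos [Finite T] (v : T) : 0 < subtreeSize v :=
  (Set.ncard_pos (Set.toFinite _)).2 ⟨v, Set.mem_Ici.2 le_rfl⟩

theorem subtreeSize_anti [Finite T] {v w : T} (h : v ≤ w) : subtreeSize w ≤ subtreeSize v :=
  Set.ncard_le_ncard (Set.Ici_subset_Ici.2 h) (Set.toFinite _)

theorem subtreeSize_le_card [Fintype T] (v : T) : subtreeSize v ≤ Fintype.card T := by
  rw [← Nat.card_eq_fintype_card]
  exact Set.ncard_le_card _

theorem subtreeSize_le_one_add_sum [Finite T] {v : T} {d : ℕ} {c : Fin d → T}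
    (hc : Set.range c = treeChildren v) :
    subtreeSize v ≤ 1 + ∑ i, subtreeSize (c i) := by
  have hsub : Set.Ici v ⊆ {v} ∪ ⋃ i, Set.Ici (c i) := by
    intro w hw
    rcases (Set.mem_Ici.1 hw).eq_or_lt with rfl | hlt
    · exact Or.inl rfl
    · obtain ⟨x, hx, hxw⟩ := exists_covBy_le_of_lt hlt
      have : x ∈ Set.range c := by rw [hc]; exact hx
      obtain ⟨i, rfl⟩ := this
      exact Or.inr (Set.mem_iUnion.2 ⟨i, hxw⟩)
  calc subtreeSize v ≤ ({v} ∪ ⋃ i, Set.Ici (c i) : Set T).ncard :=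
        Set.ncard_le_ncard hsub (Set.toFinite _)
    _ ≤ ({v} : Set T).ncard + (⋃ i, Set.Ici (c i)).ncard := Set.ncard_union_le _ _
    _ ≤ 1 + ∑ i, subtreeSize (c i) := by
        rw [Set.ncard_singleton]
        gcongr
        exact Set.ncard_iUnion_le_of_fintype _

/-- Two siblings together have fewer descendants than their parent. -/
theorem subtreeSize_add_lt [Finite T] {v c c' : T} (h : v ⋖ c) (h' : v ⋖ c') (hne : c ≠ c') :
    subtreeSize c + subtreeSize c' < subtreeSize v := by
  have hd : Disjoint (Set.Ici c) (Set.Ici c') := by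
    rw [Set.disjoint_left]
    exact fun x hx hx' => hne (h.eq_of_le_of_le h' hx hx')
  unfold subtreeSize
  rw [← Set.ncard_union_eq hd (Set.toFinite _) (Set.toFinite _)]
  apply Set.ncard_lt_ncard _ (Set.toFinite _)
  refine ⟨Set.union_subset (Set.Ici_subset_Ici.2 h.le) (Set.Ici_subset_Ici.2 h'.le), fun hs => ?_⟩
  rcases hs (Set.mem_Ici.2 le_rfl) with hv | hv
  · exact h.lt.not_ge hv
  · exact h'.lt.not_ge hv

/-- The descendants of `v` fill the positions from `pos v` on. -/
theorem exists_pos_eq [Finite T] {pos : T → ℕ} (hpos : ∀ v, HasLightFirstNeighborhood pos v)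
    (v : T) : ∀ t, pos v ≤ t → t < pos v + subtreeSize v → ∃ u, v ≤ u ∧ pos u = t := by
  induction v using WellFoundedGT.induction with
  | _ v ih =>
    intro t ht ht'
    rcases ht.eq_or_lt with rfl | hlt
    · exact ⟨v, le_rfl, rfl⟩
    obtain ⟨d, c, -, hc, -, hp⟩ := hpos v
    have := subtreeSize_le_one_add_sum hc
    obtain ⟨i, hi, hi'⟩ := Fin.exists_sum_Iio_le_lt (fun i => subtreeSize (c i))
      (show t - (pos v + 1) < _ by omega)
    have hvc : v ⋖ c i := by
      have : c i ∈ treeChildren v := hc ▸ ⟨i, rfl⟩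
      exact this
    have := hp i
    obtain ⟨u, hu, hut⟩ := ih (c i) hvc.lt t (by omega) (by omega)
    exact ⟨u, hvc.le.trans hu, hut⟩

/-- In light-first order the vertices occupy the first positions of the curve. -/
theorem image_pos_eq_range [Fintype T] {pos : T → ℕ} (hpos : IsLightFirst pos) :
    Finset.univ.image pos = Finset.range (Fintype.card T) ∧ Function.Injective pos := by
  have hsub : Finset.range (Fintype.card T) ⊆ Finset.univ.image pos := by
    intro t ht
    have hs : subtreeSize (⊥ : T) = Fintype.card T := by
      simp [subtreeSize, Set.ncard_univ]
    obtain ⟨u, -, hu⟩ := exists_pos_eq hpos.2 ⊥ t (by simp [hpos.1])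
      (by rw [hpos.1, hs, zero_add]; exact Finset.mem_range.1 ht)
    exact Finset.mem_image.2 ⟨u, Finset.mem_univ _, hu⟩
  -- The image has at most `card T` elements, so covering the range forces equality and injectivity.
  have heq := Finset.eq_of_subset_of_card_le hsub
    (by rw [Finset.card_range]; exact Finset.card_image_le)
  refine ⟨heq.symm, ?_⟩
  rw [← Set.injOn_univ, ← Finset.coe_univ, ← Finset.card_image_iff, ← heq, Finset.card_range,
    Finset.card_univ]

/-- A child is light if it has a sibling with a subtree that is at least as large. -/
def IsLightChild (v c : T) : Prop :=
  v ⋖ c ∧ ∃ c', v ⋖ c' ∧ c ≠ c' ∧ subtreeSize c ≤ subtreeSize c'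

theorem IsLightChild.two_mul_lt [Finite T] {v c : T} (h : IsLightChild v c) :
    2 * subtreeSize c < subtreeSize v := by
  obtain ⟨hc, c', hc', hne, hle⟩ := h
  have := subtreeSize_add_lt hc hc' hne
  omega

/-- The positions between a vertex and its child hold the vertex itself and the descendants of its
light children. -/
theorem exists_pos_eq_of_mem_Ico [Finite T] {pos : T → ℕ}
    (hpos : ∀ v, HasLightFirstNeighborhood pos v) {v c : T} (hvc : v ⋖ c) :
    pos v < pos c ∧ ∀ t ∈ Finset.Ico (pos v) (pos c), ∃ u, pos u = t ∧
      (u = v ∨ ∃ c', IsLightChild v c' ∧ c' ≤ u ∧ subtreeSize c' ≤ pos c - pos v) := by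
  obtain ⟨d, f, hinj, hf, hmono, hp⟩ := hpos v
  obtain ⟨i, rfl⟩ : c ∈ Set.range f := hf ▸ hvc
  have hcov : ∀ j, v ⋖ f j := fun j => by
    have : f j ∈ treeChildren v := hf ▸ ⟨j, rfl⟩
    exact this
  have hpi := hp i
  refine ⟨by omega, fun t ht => ?_⟩
  rw [Finset.mem_Ico] at ht
  rcases ht.1.eq_or_lt with rfl | hlt
  · exact ⟨v, rfl, Or.inl rfl⟩
  have hsum : ∑ j ∈ Finset.Iio i, subtreeSize (f j) ≤ ∑ j, subtreeSize (f j) :=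
    Finset.sum_le_sum_of_subset (Finset.subset_univ _)
  obtain ⟨j, hj, hj'⟩ := Fin.exists_sum_Iio_le_lt (fun i => subtreeSize (f i))
    (show t - (pos v + 1) < _ by omega)
  have hji : j < i := by
    by_contra hji
    have : ∑ k ∈ Finset.Iio i, subtreeSize (f k) ≤ ∑ k ∈ Finset.Iio j, subtreeSize (f k) :=
      Finset.sum_le_sum_of_subset (Finset.Iio_subset_Iio (not_lt.1 hji))
    omega
  have hpj := hp j
  obtain ⟨u, hu, hut⟩ := exists_pos_eq hpos (f j) t (by omega) (by omega)
  refine ⟨u, hut, Or.inr ⟨f j, ⟨hcov j, f i, hcov i, hinj.ne hji.ne, hmono hji.le⟩, hu, ?_⟩⟩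
  have : subtreeSize (f j) ≤ ∑ k ∈ Finset.Iio i, subtreeSize (f k) :=
    Finset.single_le_sum (f := fun k => subtreeSize (f k)) (fun _ _ => Nat.zero_le _)
      (Finset.mem_Iio.2 hji)
  omega

open Classical in
/-- The light children among the ancestors of `u`. -/
noncomputable def lightAncestors [Fintype T] (u : T) : Finset T :=
  {c : T | c ≤ u ∧ ∃ v, IsLightChild v c}

/-- Ancestors of `u` form a chain, and a proper ancestor of a light child contains its parent's
subtree, which is more than twice as large. -/
theorem injOn_log_subtreeSize [Fintype T] (u : T) :
    Set.InjOn (fun c : T => Nat.log 2 (subtreeSize c)) (lightAncestors u) := by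
  have key : ∀ c c' : T, c < c' → (∃ v, IsLightChild v c') →
      Nat.log 2 (subtreeSize c) ≠ Nat.log 2 (subtreeSize c') := by
    rintro c c' hlt ⟨v, hv⟩
    have hcv : c ≤ v := by
      rw [← hv.1.pred_eq]
      exact Order.le_pred_of_lt hlt
    have h1 := subtreeSize_anti hcv
    have h2 := hv.two_mul_lt
    have h3 : Nat.log 2 (subtreeSize c' * 2) ≤ Nat.log 2 (subtreeSize c) :=
      Nat.log_mono_right (by omega)
    rw [Nat.log_mul_base (by norm_num) (subtreeSize_pos c').ne'] at h3
    omega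
  intro c hc c' hc' heq
  simp only [lightAncestors, Finset.coe_filter, Finset.mem_univ, true_and,
    Set.mem_ofPred_eq] at hc hc'
  by_contra hne
  rcases le_total_of_directed hc.1 hc'.1 with hle | hle
  · exact key c' c (lt_of_le_of_ne hle (Ne.symm hne)) hc.2 heq.symm
  · exact key c c' (lt_of_le_of_ne hle hne) hc'.2 heq

open Classical in
/-- If the cost of an edge is bounded by a sum over the positions between its ends, the total cost
is bounded by a sum over the vertices and their light ancestors. -/
theorem sum_cost_le [Fintype T] {pos : T → ℕ} (hpos : ∀ v, HasLightFirstNeighborhood pos v)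
    {Δ : ℕ} (hΔ : ∀ v : T, (treeChildren v).ncard ≤ Δ) (D : ℕ → ℕ → ℝ) (g : ℕ → ℕ → ℝ)
    (hg : ∀ s t, 0 ≤ g s t) (hanti : ∀ t, Antitone fun s => g s t)
    (hD : ∀ v c : T, v ⋖ c →
      D (pos v) (pos c) ≤ ∑ t ∈ Finset.Ico (pos v) (pos c), g (pos c - pos v) t) :
    ∑ v : T, ∑ c : T with c ∈ treeChildren v, D (pos v) (pos c) ≤
      Δ * ∑ u : T, (g 1 (pos u) + ∑ c ∈ lightAncestors u, g (subtreeSize c) (pos u)) := by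
  -- `F v u` bounds what `u` pays for any one edge leaving `v`; it does not depend on the child,
  -- whence the factor `Δ`.
  let F : T → T → ℝ := fun v u => (if u = v then g 1 (pos u) else 0) +
    ∑ c : T with IsLightChild v c ∧ c ≤ u, g (subtreeSize c) (pos u)
  have hF : ∀ v u, 0 ≤ F v u := fun v u =>
    add_nonneg (by split_ifs <;> simp [hg]) (Finset.sum_nonneg fun _ _ => hg _ _)
  have hedge : ∀ v c : T, v ⋖ c → D (pos v) (pos c) ≤ ∑ u, F v u := by
    intro v c hvc
    obtain ⟨hlt, hcover⟩ := exists_pos_eq_of_mem_Ico hpos hvc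
    choose! w hw hw' using hcover
    refine (hD v c hvc).trans ?_
    have hinj : Set.InjOn w (Finset.Ico (pos v) (pos c)) := by
      intro t ht t' ht' heq
      rw [← hw t ht, ← hw t' ht', heq]
    calc ∑ t ∈ Finset.Ico (pos v) (pos c), g (pos c - pos v) t
        ≤ ∑ t ∈ Finset.Ico (pos v) (pos c), F v (w t) := by
          refine Finset.sum_le_sum fun t ht => ?_
          rcases hw' t ht with h | ⟨c', hc', hle, hs⟩
          · have h1 : g (pos c - pos v) t ≤ g 1 t := hanti t (by omega)
            have h2 : 0 ≤ ∑ c : T with IsLightChild v c ∧ c ≤ w t, g (subtreeSize c) (pos (w t)) :=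
              Finset.sum_nonneg fun _ _ => hg _ _
            simp only [F, if_pos h]
            rw [hw t ht] at h2 ⊢
            linarith
          · have h1 : g (pos c - pos v) t ≤ g (subtreeSize c') t := hanti t hs
            have h2 := Finset.single_le_sum (s := {c : T | IsLightChild v c ∧ c ≤ w t})
              (f := fun c => g (subtreeSize c) (pos (w t))) (fun _ _ => hg _ _)
              (a := c') (by simp [hc', hle])
            have h3 : 0 ≤ if w t = v then g 1 (pos (w t)) else 0 := by split_ifs <;> simp [hg]
            simp only [F]
            simp only [hw t ht] at h2 h3 ⊢
            linarith
      _ = ∑ u ∈ (Finset.Ico (pos v) (pos c)).image w, F v u := (Finset.sum_image hinj).symm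
      _ ≤ ∑ u, F v u :=
          Finset.sum_le_sum_of_subset_of_nonneg (Finset.subset_univ _) fun u _ _ => hF v u
  calc ∑ v : T, ∑ c : T with c ∈ treeChildren v, D (pos v) (pos c)
      ≤ ∑ v : T, Δ * ∑ u, F v u := by
        refine Finset.sum_le_sum fun v _ => ?_
        refine (Finset.sum_le_card_nsmul _ _ (∑ u, F v u) fun c hc => ?_).trans ?_
        · exact hedge v c (Finset.mem_filter.1 hc).2
        · rw [nsmul_eq_mul]
          refine mul_le_mul_of_nonneg_right ?_ (Finset.sum_nonneg fun u _ => hF v u)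
          have := hΔ v
          rw [Set.ncard_eq_toFinset_card'] at this
          norm_cast
          refine le_trans (Finset.card_le_card ?_) this
          intro x; simp
    _ = Δ * ∑ u, ∑ v, F v u := by rw [← Finset.mul_sum, Finset.sum_comm]
    _ ≤ _ := by
        refine mul_le_mul_of_nonneg_left (Finset.sum_le_sum fun u _ => ?_) (Nat.cast_nonneg _)
        simp only [F]
        rw [Finset.sum_add_distrib, Finset.sum_ite_eq]
        simp only [Finset.mem_univ, if_true]
        gcongr
        -- Parents are unique, so the light children of distinct `v` are disjoint.
        rw [← Finset.sum_biUnion]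
        · refine Finset.sum_le_sum_of_subset_of_nonneg ?_ fun _ _ _ => hg _ _
          intro c
          simp only [Finset.mem_biUnion, Finset.mem_univ, true_and, Finset.mem_filter,
            lightAncestors]
          rintro ⟨v, hv, hc⟩
          exact ⟨hc, v, hv⟩
        · intro v _ v' _ hne
          simp only [Function.onFun]
          rw [Finset.disjoint_left]
          intro c hc hc'
          simp only [Finset.mem_filter] at hc hc'
          exact hne (hc.2.1.1.pred_eq.symm.trans hc'.2.1.1.pred_eq)

end Tree

/-! ### Charges and their summation -/

/-- The energy charged to the step from position `t` by an edge whose length is about `4 ^ m`: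
its share of the square root of the length, and the cost of crossing the boundary of a block of
the Z-order curve that is larger than the edge (sizes up to `4 ^ (N - 1)`). -/
noncomputable def stepCharge (N m t : ℕ) : ℝ :=
  8 * (1 / 2) ^ m + 4 * ∑ k ∈ Finset.range N, if m < k ∧ 4 ^ k ∣ t + 1 then (2 : ℝ) ^ k else 0

theorem stepCharge_crossing_nonneg (m k t : ℕ) :
    0 ≤ if m < k ∧ 4 ^ k ∣ t + 1 then (2 : ℝ) ^ k else 0 := by
  split_ifs <;> positivity

theorem stepCharge_nonneg (N m t : ℕ) : 0 ≤ stepCharge N m t := by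
  have := Finset.sum_nonneg fun k (_ : k ∈ Finset.range N) => stepCharge_crossing_nonneg m k t
  unfold stepCharge
  positivity

theorem stepCharge_antitone (N t : ℕ) : Antitone fun m => stepCharge N m t := by
  intro m m' h
  have h1 : (1 / 2 : ℝ) ^ m' ≤ (1 / 2) ^ m :=
    pow_le_pow_of_le_one (by norm_num) (by norm_num) h
  have h2 : ∀ k ∈ Finset.range N, (if m' < k ∧ 4 ^ k ∣ t + 1 then (2 : ℝ) ^ k else 0) ≤
      if m < k ∧ 4 ^ k ∣ t + 1 then (2 : ℝ) ^ k else 0 := by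
    intro k _
    by_cases hk : m' < k ∧ 4 ^ k ∣ t + 1
    · rw [if_pos hk, if_pos ⟨h.trans_lt hk.1, hk.2⟩]
    · rw [if_neg hk]
      exact stepCharge_crossing_nonneg m k t
  have h3 := Finset.sum_le_sum h2
  simp only [stepCharge]
  linarith

theorem curveEnergy_zCurve_le_sum_stepCharge {N i j : ℕ} (hij : i < j) (hj : j < N) :
    (curveEnergy zCurve i j : ℝ) ≤
      ∑ t ∈ Finset.Ico i j, stepCharge N (Nat.log 2 (j - i) / 2) t := by
  set s := j - i with hs
  set m := Nat.log 2 s / 2 with hm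
  have hlow : 4 ^ m ≤ s := by
    rw [show 4 = 2 ^ 2 by norm_num, ← pow_mul]
    exact (Nat.pow_le_pow_right (by norm_num) (by omega)).trans (Nat.pow_log_le_self 2 (by omega))
  -- The geometric bound is applied at scale `m + 1`: hence the strict `m < k` and the constant `8`
  -- in `stepCharge`.
  have hup : s ≤ 4 ^ (m + 1) := by
    rw [show 4 = 2 ^ 2 by norm_num, ← pow_mul]
    exact (Nat.lt_pow_succ_log_self (by norm_num) s).le.trans
      (Nat.pow_le_pow_right (by norm_num) (by omega))
  have hsum : ∑ t ∈ Finset.Ico i j, stepCharge N m t = s * (8 * (1 / 2) ^ m) +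
      ∑ t ∈ Finset.Ico i j, 4 * ∑ k ∈ Finset.range N,
        if m < k ∧ 4 ^ k ∣ t + 1 then (2 : ℝ) ^ k else 0 := by
    simp only [stepCharge]
    rw [Finset.sum_add_distrib, Finset.sum_const, Nat.card_Ico, nsmul_eq_mul]
  have hroot : (8 : ℝ) * 2 ^ m ≤ s * (8 * (1 / 2) ^ m) := by
    have h1 : (4 : ℝ) ^ m ≤ s := by exact_mod_cast hlow
    have h2 : (4 : ℝ) ^ m * (1 / 2) ^ m = 2 ^ m := by
      rw [← mul_pow]
      norm_num
    have h3 : (4 : ℝ) ^ m * (1 / 2) ^ m ≤ s * (1 / 2) ^ m := by gcongr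
    linarith
  have hnn : ∀ t, 0 ≤ 4 * ∑ k ∈ Finset.range N,
      if m < k ∧ 4 ^ k ∣ t + 1 then (2 : ℝ) ^ k else 0 := fun t =>
    mul_nonneg (by norm_num) (Finset.sum_nonneg fun k _ => stepCharge_crossing_nonneg m k t)
  rw [hsum]
  rcases curveEnergy_zCurve_le hij.le hup with h | ⟨k, t, ht, hmk, hdvd, h⟩
  · have h' : (curveEnergy zCurve i j : ℝ) ≤ 4 * 2 ^ (m + 1) := by exact_mod_cast h
    rw [pow_succ] at h'
    have := Finset.sum_nonneg fun t (_ : t ∈ Finset.Ico i j) => hnn t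
    linarith
  · have h' : (curveEnergy zCurve i j : ℝ) ≤ 4 * 2 ^ (m + 1) + 4 * 2 ^ k := by exact_mod_cast h
    rw [pow_succ] at h'
    -- `k < 4 ^ k ≤ t + 1 ≤ j < N`, so truncation at `N` loses no crossing.
    have hkN : k < N := by
      have h1 := Nat.le_of_dvd (Nat.succ_pos t) hdvd
      have h2 : k < 4 ^ k := Nat.lt_pow_self (by norm_num)
      have := (Finset.mem_Ico.1 ht).2
      omega
    have h1 := Finset.single_le_sum (fun t _ => hnn t) ht
    have h2 := Finset.single_le_sum (s := Finset.range N)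
      (fun k _ => stepCharge_crossing_nonneg m k t) (Finset.mem_range.2 hkN)
    rw [if_pos ⟨hmk, hdvd⟩] at h2
    linarith

theorem sum_range_two_mul_half (f : ℕ → ℝ) (N : ℕ) :
    ∑ l ∈ Finset.range (2 * N), f (l / 2) = 2 * ∑ m ∈ Finset.range N, f m := by
  induction N with
  | zero => simp
  | succ N ih =>
    rw [Nat.mul_succ, Finset.sum_range_succ, Finset.sum_range_succ, ih, Finset.sum_range_succ,
      show 2 * N / 2 = N by omega, show (2 * N + 1) / 2 = N by omega]
    ring

theorem sum_range_mul_half_pow (N : ℕ) :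
    ∑ k ∈ Finset.range N, (k : ℝ) * (1 / 2) ^ k = 2 - 2 * (N + 1) * (1 / 2) ^ N := by
  induction N with
  | zero => simp
  | succ N ih =>
    rw [Finset.sum_range_succ, ih, pow_succ]
    push_cast
    ring

theorem sum_stepCharge_le (N t : ℕ) :
    ∑ m ∈ Finset.range N, stepCharge N m t ≤
      16 + 4 * ∑ k ∈ Finset.range N, if 4 ^ k ∣ t + 1 then (k : ℝ) * 2 ^ k else 0 := by
  simp only [stepCharge]
  rw [Finset.sum_add_distrib, ← Finset.mul_sum, ← Finset.mul_sum, Finset.sum_comm]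
  have h1 := sum_geometric_two_le N
  have h2 : ∀ k ∈ Finset.range N,
      (∑ m ∈ Finset.range N, if m < k ∧ 4 ^ k ∣ t + 1 then (2 : ℝ) ^ k else 0) ≤
        if 4 ^ k ∣ t + 1 then (k : ℝ) * 2 ^ k else 0 := by
    intro k _
    by_cases hd : 4 ^ k ∣ t + 1
    · simp only [hd, and_true, if_true]
      rw [← Finset.sum_filter, Finset.sum_const, nsmul_eq_mul]
      gcongr
      calc _ ≤ (Finset.range k).card := Finset.card_le_card fun m hm =>
            Finset.mem_range.2 (Finset.mem_filter.1 hm).2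
        _ = k := Finset.card_range k
    · simp [hd]
  have h3 := Finset.sum_le_sum h2
  linarith

theorem sum_sum_stepCharge_le (N : ℕ) :
    ∑ t ∈ Finset.range N, ∑ m ∈ Finset.range N, stepCharge N m t ≤ 24 * N := by
  have h : ∀ k ∈ Finset.range N,
      (∑ t ∈ Finset.range N, if 4 ^ k ∣ t + 1 then (k : ℝ) * 2 ^ k else 0) ≤
        N * (k * (1 / 2) ^ k) := by
    intro k _
    rw [← Finset.sum_filter, Finset.sum_const, nsmul_eq_mul, Nat.card_multiples]
    have h1 : ((N / 4 ^ k : ℕ) : ℝ) ≤ N / 4 ^ k := by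
      simpa using (Nat.cast_div_le (α := ℝ) (m := N) (n := 4 ^ k))
    have h2 : (2 : ℝ) ^ k / 4 ^ k = (1 / 2) ^ k := by
      rw [← div_pow]
      norm_num
    calc ((N / 4 ^ k : ℕ) : ℝ) * (k * 2 ^ k) ≤ N / 4 ^ k * (k * 2 ^ k) := by gcongr
      _ = N * (k * (2 ^ k / 4 ^ k)) := by ring
      _ = _ := by rw [h2]
  calc ∑ t ∈ Finset.range N, ∑ m ∈ Finset.range N, stepCharge N m t
      ≤ ∑ t ∈ Finset.range N, (16 + 4 * ∑ k ∈ Finset.range N,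
          if 4 ^ k ∣ t + 1 then (k : ℝ) * 2 ^ k else 0) :=
        Finset.sum_le_sum fun t _ => sum_stepCharge_le N t
    _ = 16 * N + 4 * ∑ k ∈ Finset.range N, ∑ t ∈ Finset.range N,
          if 4 ^ k ∣ t + 1 then (k : ℝ) * 2 ^ k else 0 := by
        rw [Finset.sum_add_distrib, ← Finset.mul_sum, Finset.sum_comm, Finset.sum_const,
          Finset.card_range, nsmul_eq_mul]
        ring
    _ ≤ 16 * N + 4 * (N * 2) := by
        gcongr
        refine (Finset.sum_le_sum h).trans ?_
        rw [← Finset.mul_sum, sum_range_mul_half_pow]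
        gcongr
        have : (0 : ℝ) ≤ 2 * (N + 1) * (1 / 2) ^ N := by positivity
        linarith
    _ = 24 * N := by ring

/-- Light ancestors have distinct binary logarithms, and each base-4 scale contains two of these:
hence the factor `2`. -/
theorem sum_lightAncestors_stepCharge_le {T : RootedTree.{u}} [Fintype T] (v : T) (t : ℕ) :
    ∑ c ∈ lightAncestors v, stepCharge (Fintype.card T) (Nat.log 2 (subtreeSize c) / 2) t ≤
      2 * ∑ m ∈ Finset.range (Fintype.card T), stepCharge (Fintype.card T) m t := by
  classical
  rw [← sum_range_two_mul_half,
    ← Finset.sum_image (f := fun l => stepCharge (Fintype.card T) (l / 2) t)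
      (injOn_log_subtreeSize v)]
  refine Finset.sum_le_sum_of_subset_of_nonneg ?_ fun _ _ _ => stepCharge_nonneg _ _ _
  intro l hl
  obtain ⟨c, -, rfl⟩ := Finset.mem_image.1 hl
  have h1 := Nat.log_lt_self 2 (subtreeSize_pos c).ne'
  have h2 := subtreeSize_le_card c
  rw [Finset.mem_range]
  omega

theorem isLightFirstEnergyBound_zCurve : IsLightFirstEnergyBound.{u} zCurve := by
  intro Δ
  -- `96 = 4 * 24`: light ancestors contribute `2` and the vertex itself `1`, rounded up to `4`;
  -- `24` is the average charge over all scales.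
  refine ⟨96 * Δ, fun T _ pos hΔ hpos => ?_⟩
  set N := Fintype.card T with hN
  obtain ⟨himage, hinj⟩ := image_pos_eq_range hpos
  have hlt : ∀ v, pos v < N := fun v => by
    rw [← Finset.mem_range, ← himage]
    exact Finset.mem_image_of_mem _ (Finset.mem_univ v)
  have hcost := sum_cost_le hpos.2 hΔ (fun i j => (curveEnergy zCurve i j : ℝ))
    (fun s t => stepCharge N (Nat.log 2 s / 2) t) (fun _ _ => stepCharge_nonneg _ _ _)
    (fun t s s' h => stepCharge_antitone N t (Nat.div_le_div_right (Nat.log_mono_right h)))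
    (fun v c hvc => curveEnergy_zCurve_le_sum_stepCharge
      (exists_pos_eq_of_mem_Ico hpos.2 hvc).1 (hlt c))
  have hvertex : ∀ v : T, stepCharge N (Nat.log 2 1 / 2) (pos v) +
      ∑ c ∈ lightAncestors v, stepCharge N (Nat.log 2 (subtreeSize c) / 2) (pos v) ≤
        4 * ∑ m ∈ Finset.range N, stepCharge N m (pos v) := by
    intro v
    have h1 := sum_lightAncestors_stepCharge_le v (pos v)
    have h2 := Finset.single_le_sum (s := Finset.range N)
      (f := fun m => stepCharge N m (pos v)) (fun m _ => stepCharge_nonneg N m (pos v))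
      (Finset.mem_range.2 (Nat.zero_lt_of_lt (hlt v)))
    have h3 := stepCharge_nonneg N 0 (pos v)
    simp only [Nat.log_one_right, Nat.zero_div]
    linarith
  have htotal : ∑ v : T, ∑ m ∈ Finset.range N, stepCharge N m (pos v) ≤ 24 * N := by
    rw [← Finset.sum_image (f := fun t => ∑ m ∈ Finset.range N, stepCharge N m t) hinj.injOn,
      himage]
    exact sum_sum_stepCharge_le N
  unfold messagingEnergy
  push_cast
  calc _ ≤ _ := hcost
    _ ≤ Δ * ∑ v : T, 4 * ∑ m ∈ Finset.range N, stepCharge N m (pos v) := by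
        gcongr with v
        exact hvertex v
    _ = Δ * (4 * ∑ v : T, ∑ m ∈ Finset.range N, stepCharge N m (pos v)) := by
        rw [← Finset.mul_sum]
    _ ≤ Δ * (4 * (24 * N)) := by gcongr
    _ = 96 * Δ * N := by ring

theorem mainTheorem2 :
    IsLightFirstEnergyBound.{u} zCurve ∧ ¬ IsDistanceBound zCurve :=
  ⟨isLightFirstEnergyBound_zCurve, not_isDistanceBound_zCurve⟩
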